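/- Let $\mathcal T$ be the binary rooted tree, with vertex set $\{0,1\}^*$ (the finite words over $\{0,1\}$) and an edge joining $v$ to $v\epsilon$ for all $v\in\{0,1\}^*$, $\epsilon\in\{0,1\}$. Let $\Gamma$ be the first Grigorchuk group, that is, the subgroup of $\mathrm{Aut}(\mathcal T)$ generated by the automorphisms $a,b,c,d$ that fix the empty word and satisfy, for all words $w$, $$a(0w)=1w,\quad a(1w)=0w,\quad b(0w)=0\,a(w),\quad b(1w)=1\,c(w),$$ $$c(0w)=0\,a(w),\quad c(1w)=1\,d(w),\quad d(0w)=0w,\quad d(1w)=1\,b(w).$$ Let $S$ be a finite generating set of $\Gamma$, let $|\cdot|_S$ be the word length on $\Gamma$ with respect to $S$, let $k\ge 2$ be an integer, and let $F_k$ be the free group of rank $k$, with $|w|$ the length of the reduced word $w\in F_k$. Then no nontrivial $w\in F_k$ is a law for $\Gamma$ (a law being a nontrivial word $w$ with $w(g_1,\dots,g_k)=1$ for all $g_1,\dots,g_k\in\Gamma$), so that the complexity $$\chi_\Gamma^S(w)=\min\Big\{\sum_{i=1}^k|g_i|_S : g_1,\dots,g_k\in\Gamma,\ w(g_1,\dots,g_k)\ne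 1\Big\}$$ is defined for every $1\neq w\in F_k$. Moreover, the lawlessness growth function $$\mathcal A_\Gamma^S(n)=\max\{\chi_\Gamma^S(w) : 1\ne w\in F_k,\ |w|\le n\}$$ (with $\mathcal A_\Gamma^S(0)=0$) satisfies, for some $C>0$, $$n^{2/3}\ll\mathcal A_\Gamma^S(n)\ll\exp(Cn),$$ that is, there are constants $C,c,K>0$ (which may depend on $k$ and $S$) such that $c\,n^{2/3}\le\mathcal A_\Gamma^S(n)\le K\exp(Cn)$ for all $n\in\mathbb N$. -/

import Mathlib

/-! ### Word length in a group with respect to a set of generators -/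

/-- The word length of `g` with respect to `S`: the least length of a word in the letters of `S` and
their inverses that represents `g`. -/
noncomputable def wordLength {G : Type*} [Group G] (S : Set G) (g : G) : ℕ :=
  sInf {n : ℕ | ∃ l : List G, (∀ x ∈ l, x ∈ S ∨ x⁻¹ ∈ S) ∧ l.prod = g ∧ l.length = n}

/-! ### Laws, complexity of non-laws, and lawlessness growth -/

/-- The word `w` in the free group on `k` letters is a law for `G`: it is nontrivial and lies in
the kernel of every homomorphism from the free group to `G`. -/
def IsLaw {k : ℕ} (G : Type*) [Group G] (w : FreeGroup (Fin k)) : Prop :=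
  w ≠ 1 ∧ ∀ π : FreeGroup (Fin k) →* G, π w = 1

/-- The complexity of the word `w` in `G` with respect to `S`: the least total word length of a
tuple `g` with `w(g) ≠ 1`. (It is meaningful for words that do not vanish identically on `G`.) -/
noncomputable def complexity {k : ℕ} {G : Type*} [Group G] (S : Set G)
    (w : FreeGroup (Fin k)) : ℕ :=
  sInf {m : ℕ | ∃ g : Fin k → G, FreeGroup.lift g w ≠ 1 ∧ ∑ i, wordLength S (g i) = m}

/-- The lawlessness growth function of `G` with respect to `S`, for words in `k` letters: the
maximal complexity of a nontrivial element of the free group of reduced length at most `n`. There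
are only finitely many such words, so that this supremum is a maximum; for `n = 0` there are none,
and the value is `0`. -/
noncomputable def lawlessnessGrowth (k : ℕ) {G : Type*} [Group G] (S : Set G) (n : ℕ) : ℕ :=
  sSup {m : ℕ | ∃ w : FreeGroup (Fin k), w ≠ 1 ∧ w.norm ≤ n ∧ complexity S w = m}

/-! ### The binary rooted tree and the first Grigorchuk group -/

/-- The binary rooted tree: its vertices are the finite words over `{0, 1}` (`false` is `0` and
`true` is `1`), and there is an edge between `v` and `vε` for every word `v` and letter `ε`. -/
def binaryTree : SimpleGraph (List Bool) :=
  SimpleGraph.fromRel fun v u => ∃ ε : Bool, u = v ++ [ε]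

/-- An involution of the vertices that maps every child of `v` to a child of the image of `v` is an
automorphism of the tree. -/
def treeInvolution (f : List Bool → List Bool) (hf : Function.Involutive f)
    (hc : ∀ (v : List Bool) (ε : Bool), ∃ δ : Bool, f (v ++ [ε]) = f v ++ [δ]) :
    binaryTree ≃g binaryTree where
  toEquiv := hf.toPerm f
  map_rel_iff' := by
    have key : ∀ v u, binaryTree.Adj v u → binaryTree.Adj (f v) (f u) := by
      intro v u h
      rw [binaryTree, SimpleGraph.fromRel_adj] at h ⊢
      obtain ⟨hne, h⟩ := h
      refine ⟨fun e => hne (hf.injective e), ?_⟩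
      rcases h with ⟨ε, rfl⟩ | ⟨ε, rfl⟩
      · exact Or.inl (hc _ ε)
      · exact Or.inr (hc _ ε)
    intro v u
    refine ⟨fun h => ?_, key v u⟩
    have h' := key _ _ h
    simpa [Function.Involutive.coe_toPerm, hf v, hf u] using h'

/-- The action of `a` on words: it changes the first letter. -/
def actA : List Bool → List Bool
  | [] => []
  | ε :: w => (!ε) :: w

mutual

/-- The action of `b` on words: `b = (a, c)`. -/
def actB : List Bool → List Bool
  | [] => []
  | false :: w => false :: actA w
  | true :: w => true :: actC w

/-- The action of `c` on words: `c = (a, d)`. -/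
def actC : List Bool → List Bool
  | [] => []
  | false :: w => false :: actA w
  | true :: w => true :: actD w

/-- The action of `d` on words: `d = (1, b)`. -/
def actD : List Bool → List Bool
  | [] => []
  | false :: w => false :: w
  | true :: w => true :: actB w

end

theorem actA_involutive : Function.Involutive actA := by
  intro v
  cases v <;> simp [actA]

theorem actBCD_involutive (v : List Bool) :
    actB (actB v) = v ∧ actC (actC v) = v ∧ actD (actD v) = v := by
  induction v with
  | nil => simp [actB, actC, actD]
  | cons ε w ih => cases ε <;> simp [actB, actC, actD, ih, actA_involutive w]

theorem actA_child (v : List Bool) (ε : Bool) : ∃ δ : Bool, actA (v ++ [ε]) = actA v ++ [δ] := by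
  cases v <;> simp [actA]

theorem actBCD_child (v : List Bool) (ε : Bool) :
    (∃ δ : Bool, actB (v ++ [ε]) = actB v ++ [δ]) ∧
      (∃ δ : Bool, actC (v ++ [ε]) = actC v ++ [δ]) ∧
        ∃ δ : Bool, actD (v ++ [ε]) = actD v ++ [δ] := by
  induction v with
  | nil => cases ε <;> simp [actA, actB, actC, actD]
  | cons x w ih =>
    obtain ⟨hb, hc, hd⟩ := ih
    have ha := actA_child w ε
    cases x <;> simp [actB, actC, actD, ha, hb, hc, hd]

/-- A generator of the first Grigorchuk group. -/
def grigA : binaryTree ≃g binaryTree :=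
  treeInvolution actA actA_involutive actA_child

/-- A generator of the first Grigorchuk group. -/
def grigB : binaryTree ≃g binaryTree :=
  treeInvolution actB (fun v => (actBCD_involutive v).1) fun v ε => (actBCD_child v ε).1

/-- A generator of the first Grigorchuk group. -/
def grigC : binaryTree ≃g binaryTree :=
  treeInvolution actC (fun v => (actBCD_involutive v).2.1) fun v ε => (actBCD_child v ε).2.1

/-- A generator of the first Grigorchuk group. -/
def grigD : binaryTree ≃g binaryTree :=
  treeInvolution actD (fun v => (actBCD_involutive v).2.2) fun v ε => (actBCD_child v ε).2.2

/-- The first Grigorchuk group: the subgroup of the automorphism group of the binary rooted tree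
generated by `a`, `b`, `c` and `d`. -/
def grigorchukGroup : Subgroup (binaryTree ≃g binaryTree) :=
  Subgroup.closure {grigA, grigB, grigC, grigD}

-- Lower bound. Elements of length at most N have order dividing a power of two of size O(N^(3/2)),
-- so a power of a free generator with exponent of that size has complexity of order at least N. For
-- the order bound (`wordAct_iterate_two_pow`), take an alternating word for the element. If it
-- fixes the first level, each section has about half of its letters other than a. If not, its
-- square fixes that level, and each section of the square has no more such letters than the word;
-- this costs a factor 2 of the exponent. The number of squarings is controlled by a potential,
-- `torsionWeight`, read off mainly from the abelianization: it drops by at least 2 at every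
-- squaring and rises by at most 3 at every halving, hence 3/2 squarings per halving on average.
--
-- Upper bound and lawlessness. Given a reduced word of length n, a tuple and a vertex of level 2n
-- are built letter by letter so that the images of the vertex under all suffixes of the word are
-- distinct (`exists_isFreeTraj_cons`); in particular a nontrivial word moves the vertex. If a new
-- letter brings the trajectory back to an earlier point, the generator of that letter is multiplied
-- by an element of a rigid stabilizer, which moves the new endpoint and no earlier point. A
-- substitution of Lysenok's type supplies such elements with length O(3^level)
-- (`exists_rigid_word`), so the total length is O(9^n).

/-! ### Words in the generators of the Grigorchuk group -/

/-- The letters of words in the generators of the Grigorchuk group. -/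
inductive GrigLetter
  | a
  | b
  | c
  | d

namespace GrigLetter

/-- The action of a letter on the vertices of the tree. -/
def act : GrigLetter → List Bool → List Bool
  | a => actA
  | b => actB
  | c => actC
  | d => actD

/-- The action of a letter on the first level. -/
def bit : GrigLetter → Bool → Bool
  | a, ε => !ε
  | _, ε => ε

/-- The section of a letter at a vertex of the first level, as a word. -/
def sec : GrigLetter → Bool → List GrigLetter
  | a, _ => []
  | b, false => [a]
  | b, true => [c]
  | c, false => [a]
  | c, true => [d]
  | d, false => []
  | d, true => [b]

theorem act_nil (x : GrigLetter) : x.act [] = [] := by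
  cases x <;> simp [act, actA, actB, actC, actD]

theorem act_involutive (x : GrigLetter) : Function.Involutive x.act := by
  cases x
  · exact actA_involutive
  · exact fun v => (actBCD_involutive v).1
  · exact fun v => (actBCD_involutive v).2.1
  · exact fun v => (actBCD_involutive v).2.2

end GrigLetter

open GrigLetter in
/-- The action of a word on the vertices of the tree; the last letter acts first. -/
def wordAct : List GrigLetter → List Bool → List Bool
  | [], v => v
  | x :: w, v => x.act (wordAct w v)

/-- The action of a word on the first level. -/
def wordBit : List GrigLetter → Bool → Bool
  | [], ε => ε
  | x :: w, ε => x.bit (wordBit w ε)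

/-- The section of a word at a vertex of the first level. -/
def wordSec : List GrigLetter → Bool → List GrigLetter
  | [], _ => []
  | x :: w, ε => x.sec (wordBit w ε) ++ wordSec w ε

theorem wordAct_append (w u : List GrigLetter) (v : List Bool) :
    wordAct (w ++ u) v = wordAct w (wordAct u v) := by
  induction w with
  | nil => rfl
  | cons x w ih => simp [wordAct, ih]

theorem GrigLetter.act_cons (x : GrigLetter) (ε : Bool) (v : List Bool) :
    x.act (ε :: v) = x.bit ε :: wordAct (x.sec ε) v := by
  cases x <;> cases ε <;> simp [act, bit, sec, wordAct, actA, actB, actC, actD]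

theorem wordAct_nil (w : List GrigLetter) : wordAct w [] = [] := by
  induction w with
  | nil => rfl
  | cons x w ih => simp [wordAct, ih, GrigLetter.act_nil]

theorem wordAct_cons (w : List GrigLetter) (ε : Bool) (v : List Bool) :
    wordAct w (ε :: v) = wordBit w ε :: wordAct (wordSec w ε) v := by
  induction w with
  | nil => rfl
  | cons x w ih => simp [wordAct, ih, GrigLetter.act_cons, wordBit, wordSec, wordAct_append]

theorem wordBit_append (w u : List GrigLetter) (ε : Bool) :
    wordBit (w ++ u) ε = wordBit w (wordBit u ε) := by
  induction w with
  | nil => rfl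
  | cons x w ih => simp [wordBit, ih]

theorem wordSec_append (w u : List GrigLetter) (ε : Bool) :
    wordSec (w ++ u) ε = wordSec w (wordBit u ε) ++ wordSec u ε := by
  induction w with
  | nil => rfl
  | cons x w ih => simp [wordSec, ih, wordBit_append]

theorem wordBit_not (w : List GrigLetter) (ε : Bool) : wordBit w (!ε) = !wordBit w ε := by
  induction w with
  | nil => rfl
  | cons x w ih => cases x <;> simp [wordBit, ih, GrigLetter.bit]

/-! ### Parities of letters -/

/-- The sum modulo two of the values of `f` at the letters of a word. -/
def wordPar (f : GrigLetter → Bool) : List GrigLetter → Bool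
  | [] => false
  | x :: w => xor (f x) (wordPar f w)

theorem wordPar_append (f : GrigLetter → Bool) (w u : List GrigLetter) :
    wordPar f (w ++ u) = xor (wordPar f w) (wordPar f u) := by
  induction w with
  | nil => simp [wordPar]
  | cons x w ih => simp [wordPar, ih]

theorem wordPar_xor (f g : GrigLetter → Bool) (w : List GrigLetter) :
    wordPar (fun x => xor (f x) (g x)) w = xor (wordPar f w) (wordPar g w) := by
  induction w with
  | nil => simp [wordPar]
  | cons x w ih =>
    simp only [wordPar, ih]
    cases f x <;> cases g x <;> cases wordPar f w <;> cases wordPar g w <;> rfl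

theorem wordPar_wordSec {f g : GrigLetter → Bool} (h : ∀ x ε, wordPar f (x.sec ε) = g x)
    (w : List GrigLetter) (ε : Bool) : wordPar f (wordSec w ε) = wordPar g w := by
  induction w with
  | nil => rfl
  | cons x w ih => simp [wordSec, wordPar, wordPar_append, h, ih]

theorem wordPar_wordSec_xor {f g : GrigLetter → Bool}
    (h : ∀ x, xor (wordPar f (x.sec true)) (wordPar f (x.sec false)) = g x)
    (w : List GrigLetter) (ε : Bool) :
    xor (wordPar f (wordSec w (!ε))) (wordPar f (wordSec w ε)) = wordPar g w := by
  induction w with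
  | nil => simp [wordSec, wordPar]
  | cons x w ih =>
    have hx := h x
    simp only [wordSec, wordPar, wordPar_append, wordBit_not, ← ih, ← hx]
    cases wordBit w ε <;> simp only [Bool.not_false, Bool.not_true] <;>
      cases wordPar f (wordSec w ε) <;> cases wordPar f (wordSec w !ε) <;>
      cases wordPar f (x.sec true) <;> cases wordPar f (x.sec false) <;> rfl

namespace GrigLetter

/-- The indicator function of the letter `a`. -/
def isA : GrigLetter → Bool
  | a => true
  | _ => false

/-- The indicator function of the letters `b` and `d`. -/
def isBD : GrigLetter → Bool
  | b => true
  | d => true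
  | _ => false

/-- The indicator function of the letters `c` and `d`. -/
def isCD : GrigLetter → Bool
  | c => true
  | d => true
  | _ => false

end GrigLetter

open GrigLetter

theorem wordBit_eq (w : List GrigLetter) (ε : Bool) : wordBit w ε = xor (wordPar isA w) ε := by
  induction w with
  | nil => simp [wordBit, wordPar]
  | cons x w ih => cases x <;> simp [wordBit, wordPar, ih, bit, isA]

/-- The section of the square of a word. -/
theorem wordSec_append_self {w : List GrigLetter} (h : wordPar isA w = true) (ε : Bool) :
    wordSec (w ++ w) ε = wordSec w (!ε) ++ wordSec w ε := by
  rw [wordSec_append, wordBit_eq, h, Bool.true_xor]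

theorem wordPar_wordSec_append_self {f g : GrigLetter → Bool}
    (h : ∀ x, xor (wordPar f (x.sec true)) (wordPar f (x.sec false)) = g x)
    {w : List GrigLetter} (hw : wordPar isA w = true) (ε : Bool) :
    wordPar f (wordSec (w ++ w) ε) = wordPar g w := by
  rw [wordSec_append_self hw, wordPar_append, wordPar_wordSec_xor h]

/-! ### The number of letters different from `a` -/

/-- The number of letters of a word that are different from `a`. -/
def xcount : List GrigLetter → ℕ
  | [] => 0
  | a :: w => xcount w
  | _ :: w => xcount w + 1

theorem xcount_append (w u : List GrigLetter) : xcount (w ++ u) = xcount w + xcount u := by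
  induction w with
  | nil => simp [xcount]
  | cons x w ih => cases x <;> simp [xcount, ih] <;> omega

theorem xcount_le_length (w : List GrigLetter) : xcount w ≤ w.length := by
  induction w with
  | nil => simp [xcount]
  | cons x w ih => cases x <;> simp [xcount] <;> omega

/-- In b = (a,c), c = (a,d) and d = (1,b) exactly one section is a letter other than a. Sections of
a square therefore do not grow in this count. -/
theorem xcount_wordSec (w : List GrigLetter) (ε : Bool) :
    xcount (wordSec w (!ε)) + xcount (wordSec w ε) = xcount w := by
  induction w with
  | nil => simp [wordSec, xcount]
  | cons x w ih =>
    simp only [wordSec, wordBit_not, xcount_append]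
    rw [← wordBit_not]
    generalize h : wordBit w ε = β
    rw [wordBit_not, h]
    cases x <;> cases β <;> simp [sec, xcount] <;> omega

/-! ### Alternating words -/

/-- The word of length at most one that represents the product of two letters, if there is one. -/
def GrigLetter.merge : GrigLetter → GrigLetter → Option (List GrigLetter)
  | a, a => some []
  | b, b => some []
  | c, c => some []
  | d, d => some []
  | b, c => some [d]
  | c, b => some [d]
  | b, d => some [c]
  | d, b => some [c]
  | c, d => some [b]
  | d, c => some [b]
  | _, _ => none

/-- Multiplication of a word by a letter from the left, with reduction. -/
def pushLetter (x : GrigLetter) : List GrigLetter → List GrigLetter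
  | [] => [x]
  | y :: w =>
    match x.merge y with
    | none => x :: y :: w
    | some r => r ++ w

/-- The alternating word that represents the same element as a given word. -/
def reduceWord : List GrigLetter → List GrigLetter
  | [] => []
  | x :: w => pushLetter x (reduceWord w)

/-- No two adjacent letters of the word can be merged. -/
def IsAlternating (w : List GrigLetter) : Prop :=
  w.IsChain fun x y => x.merge y = none

theorem isAlternating_reduceWord (w : List GrigLetter) : IsAlternating (reduceWord w) := by
  induction w with
  | nil => simp [reduceWord, IsAlternating]
  | cons x w ih =>
    rw [reduceWord]
    match h : reduceWord w with
    | [] => simp [pushLetter, IsAlternating]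
    | [y] =>
      cases x <;> cases y <;> simp [pushLetter, IsAlternating, merge]
    | y :: z :: u =>
      rw [h] at ih
      cases x <;> cases y <;> cases z <;>
        simp_all [pushLetter, IsAlternating, merge, List.isChain_cons_cons]

theorem actBCD_mul (v : List Bool) :
    (actB (actC v) = actD v ∧ actC (actB v) = actD v) ∧
      (actB (actD v) = actC v ∧ actD (actB v) = actC v) ∧
        (actC (actD v) = actB v ∧ actD (actC v) = actB v) := by
  induction v with
  | nil => simp [actB, actC, actD]
  | cons ε w ih => cases ε <;> simp [actB, actC, actD, ih, actA_involutive w]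

theorem wordAct_pushLetter (x : GrigLetter) (w : List GrigLetter) (v : List Bool) :
    wordAct (pushLetter x w) v = wordAct (x :: w) v := by
  match w with
  | [] => rfl
  | y :: u =>
    have h1 := actBCD_involutive (wordAct u v)
    have h2 := actBCD_mul (wordAct u v)
    have h3 := actA_involutive (wordAct u v)
    cases x <;> cases y <;> simp [pushLetter, merge, wordAct, act, h1, h2, h3]

theorem wordAct_reduceWord (w : List GrigLetter) (v : List Bool) :
    wordAct (reduceWord w) v = wordAct w v := by
  induction w with
  | nil => rfl
  | cons x w ih => rw [reduceWord, wordAct_pushLetter, wordAct, wordAct, ih]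

theorem xcount_reduceWord_le (w : List GrigLetter) : xcount (reduceWord w) ≤ xcount w := by
  induction w with
  | nil => simp [reduceWord]
  | cons x w ih =>
    rw [reduceWord]
    have h : xcount (pushLetter x (reduceWord w)) ≤ xcount (x :: reduceWord w) := by
      match reduceWord w with
      | [] => exact le_rfl
      | y :: u => cases x <;> cases y <;> simp [pushLetter, merge, xcount] <;> omega
    refine h.trans ?_
    cases x <;> simpa [xcount] using ih

theorem wordPar_reduceWord {f : GrigLetter → Bool} (ha : f = isA ∨ f = isBD ∨ f = isCD)
    (w : List GrigLetter) : wordPar f (reduceWord w) = wordPar f w := by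
  induction w with
  | nil => rfl
  | cons x w ih =>
    rw [reduceWord, wordPar, ← ih]
    match reduceWord w with
    | [] => rfl
    | y :: u =>
      rcases ha with rfl | rfl | rfl <;> cases x <;> cases y <;>
        simp [pushLetter, merge, wordPar, isA, isBD, isCD]

theorem wordBit_reduceWord (w : List GrigLetter) (ε : Bool) :
    wordBit (reduceWord w) ε = wordBit w ε := by
  rw [wordBit_eq, wordBit_eq, wordPar_reduceWord (Or.inl rfl)]

/-- Needed because `torsionWeight` involves these parities and must not change under reduction. -/
theorem wordPar_isBD_wordSec_reduceWord (w : List GrigLetter) (ε : Bool) :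
    wordPar isBD (wordSec (reduceWord w) ε) = wordPar isBD (wordSec w ε) := by
  induction w with
  | nil => rfl
  | cons x w ih =>
    rw [reduceWord, wordSec, wordPar_append, ← ih, ← wordBit_reduceWord w]
    match reduceWord w with
    | [] => simp [pushLetter, wordSec, wordPar]
    | y :: u =>
      cases x <;> cases y <;> cases h : wordBit u ε <;>
        simp [pushLetter, merge, wordPar, isBD, wordSec, wordBit, h, bit, sec]

/-- The letters different from `a` of an alternating word are distributed evenly between its two
sections. -/
theorem xcount_wordSec_balanced {w : List GrigLetter} (hw : IsAlternating w) (ε : Bool)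
    (hε : wordBit w ε = true) :
    (xcount (wordSec w ε) ≤ xcount (wordSec w !ε) + 1 ∧
        xcount (wordSec w !ε) ≤ xcount (wordSec w ε) + 1) ∧
      ((∀ x ∈ w.head?, x = a) → xcount (wordSec w ε) ≤ xcount (wordSec w !ε)) ∧
        ((∀ x ∈ w.head?, x ≠ a) → xcount (wordSec w !ε) ≤ xcount (wordSec w ε)) := by
  -- The vertex ε is the one whose section receives the next letter other than a. Each a swaps the
  -- two vertices, so in an alternating word the sections receive letters in turn; the conditions on
  -- the head record which one was served last.
  induction w generalizing ε with
  | nil => simp [wordSec]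
  | cons x w ih =>
    have hw' : IsAlternating w := hw.tail
    cases x with
    | a =>
      have hε' : wordBit w (!ε) = true := by
        rw [wordBit_not]
        simpa [wordBit, bit] using hε
      obtain ⟨h1, h2, h3⟩ := ih hw' (!ε) hε'
      simp only [Bool.not_not] at h1 h2 h3
      have h4 : ∀ x ∈ w.head?, x ≠ a := by
        intro x hx h
        subst h
        cases w with
        | nil => simp at hx
        | cons y u =>
          simp only [List.head?_cons, Option.mem_def, Option.some.injEq] at hx
          subst hx
          simp [IsAlternating, merge] at hw
      have h5 := h3 h4
      simp only [wordSec, sec, List.nil_append]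
      refine ⟨by omega, fun _ => h5, ?_⟩
      simp
    | _ =>
      have hε' : wordBit w ε = true := by simpa [wordBit, bit] using hε
      obtain ⟨h1, h2, h3⟩ := ih hw' ε hε'
      have h4 : ∀ x ∈ w.head?, x = a := by
        intro x hx
        cases w with
        | nil => simp at hx
        | cons y u =>
          simp only [List.head?_cons, Option.mem_def, Option.some.injEq] at hx
          subst hx
          cases y <;> simp_all [IsAlternating, merge]
      have h5 := h2 h4
      have h6 : wordBit w (!ε) = false := by rw [wordBit_not, hε']; rfl
      simp only [wordSec, hε', h6, sec, xcount_append, xcount]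
      refine ⟨by omega, by simp, fun _ => by omega⟩

theorem two_mul_xcount_wordSec_le {w : List GrigLetter} (hw : IsAlternating w) (ε : Bool) :
    2 * xcount (wordSec w ε) ≤ xcount w + 1 := by
  have h := xcount_wordSec w ε
  cases hε : wordBit w ε with
  | true => have := (xcount_wordSec_balanced hw ε hε).1; omega
  | false =>
    have hε' : wordBit w (!ε) = true := by rw [wordBit_not, hε]; rfl
    have := (xcount_wordSec_balanced hw (!ε) hε').1
    rw [Bool.not_not] at this
    omega

/-! ### Squares of words of odd length in the level-two quotient -/

/-- Dihedral relations: a inverts the rotation ay, and y = a(ay). -/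
theorem zpow_mul_eq_of_involutions {G : Type*} [Group G] {a y : G} (ha : a * a = 1)
    (hy : y * y = 1) (k : ℤ) :
    a * (a * y) ^ k = (a * y) ^ (-k) * a ∧ y * (a * y) ^ k = (a * y) ^ (-k - 1) * a := by
  have ha' : a⁻¹ = a := inv_eq_of_mul_eq_one_left ha
  have hy' : y⁻¹ = y := inv_eq_of_mul_eq_one_left hy
  have h1 : ∀ k : ℤ, a * (a * y) ^ k = (a * y) ^ (-k) * a := by
    intro k
    have h : a * (a * y) * a⁻¹ = (a * y)⁻¹ := by
      rw [mul_inv_rev, ha', hy', ← mul_assoc, ha, one_mul]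
    have h' : (a * (a * y) * a⁻¹) ^ k = a * (a * y) ^ k * a⁻¹ := conj_zpow
    rw [h, inv_zpow', ha'] at h'
    rw [h', mul_assoc, ha, mul_one]
  refine ⟨h1 k, ?_⟩
  calc y * (a * y) ^ k = a * (a * y) * (a * y) ^ k := by rw [← mul_assoc a a y, ha, one_mul]
    _ = (a * y) ^ (-(1 + k)) * a := by rw [mul_assoc, ← zpow_one_add, h1]
    _ = (a * y) ^ (-k - 1) * a := by rw [neg_add, sub_eq_add_neg, add_comm]

/-- A product of an odd number of factors that are all equal to one of two involutions squares to
the identity. -/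
theorem list_prod_sq_of_involutions {G : Type*} [Group G] {a y : G} (ha : a * a = 1)
    (hy : y * y = 1) (l : List G) (hl : ∀ g ∈ l, g = a ∨ g = y) (hodd : Odd l.length) :
    l.prod * l.prod = 1 := by
  -- In the dihedral group, even products are rotations and odd ones are reflections.
  have key : (Even l.length → ∃ k : ℤ, l.prod = (a * y) ^ k) ∧
      (Odd l.length → ∃ k : ℤ, l.prod = (a * y) ^ k * a) := by
    clear hodd
    induction l with
    | nil => exact ⟨fun _ => ⟨0, by simp⟩, fun h => by simp at h⟩
    | cons g l ih =>
      obtain ⟨ih1, ih2⟩ := ih fun g hg => hl g (List.mem_cons_of_mem _ hg)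
      have hg := hl g List.mem_cons_self
      rw [List.length_cons, List.prod_cons]
      refine ⟨fun h => ?_, fun h => ?_⟩
      · obtain ⟨k, hk⟩ := ih2 (by rwa [Nat.even_add_one, Nat.not_even_iff_odd] at h)
        rw [hk, ← mul_assoc]
        obtain ⟨h1, h2⟩ := zpow_mul_eq_of_involutions ha hy k
        rcases hg with rfl | rfl
        · exact ⟨-k, by rw [h1, mul_assoc, ha, mul_one]⟩
        · exact ⟨-k - 1, by rw [h2, mul_assoc, ha, mul_one]⟩
      · obtain ⟨k, hk⟩ := ih1 (by rwa [Nat.odd_add_one, Nat.not_odd_iff_even] at h)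
        rw [hk]
        obtain ⟨h1, h2⟩ := zpow_mul_eq_of_involutions ha hy k
        rcases hg with rfl | rfl
        · exact ⟨-k, h1⟩
        · exact ⟨-k - 1, h2⟩
  obtain ⟨k, hk⟩ := key.2 hodd
  rw [hk, mul_assoc, ← mul_assoc a, (zpow_mul_eq_of_involutions ha hy k).1, mul_assoc, ha, mul_one,
    ← zpow_add, add_neg_cancel, zpow_zero]

/-- The action of a letter on the second level, together with the parity of the letters `b` and `d`
of the sections at that level. -/
def GrigLetter.levelTwoFun : GrigLetter → Bool × Bool × Bool → Bool × Bool × Bool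
  | a, (ε, δ, s) => (!ε, δ, s)
  | b, (false, δ, s) => (false, !δ, s)
  | b, (true, δ, s) => (true, δ, xor δ s)
  | c, (false, δ, s) => (false, !δ, s)
  | c, (true, δ, s) => (true, δ, xor δ s)
  | d, p => p

theorem GrigLetter.levelTwoFun_involutive (x : GrigLetter) :
    Function.Involutive x.levelTwoFun := by
  rintro ⟨ε, δ, s⟩
  cases x <;> cases ε <;> cases δ <;> simp [levelTwoFun]

/-- The function `GrigLetter.levelTwoFun` as a permutation. -/
def GrigLetter.levelTwo (x : GrigLetter) : Equiv.Perm (Bool × Bool × Bool) :=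
  x.levelTwoFun_involutive.toPerm

theorem GrigLetter.levelTwo_apply (x : GrigLetter) (ε δ s : Bool) :
    x.levelTwo (ε, δ, s) = (x.bit ε, wordBit (x.sec ε) δ,
      xor (wordPar isBD (wordSec (x.sec ε) δ)) s) := by
  cases x <;> cases ε <;> cases δ <;> cases s <;> rfl

theorem list_map_levelTwo_prod_apply (w : List GrigLetter) (ε δ s : Bool) :
    (w.map levelTwo).prod (ε, δ, s) = (wordBit w ε, wordBit (wordSec w ε) δ,
      xor (wordPar isBD (wordSec (wordSec w ε) δ)) s) := by
  induction w with
  | nil => simp [wordBit, wordSec, wordPar]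
  | cons x w ih =>
    rw [List.map_cons, List.prod_cons, Equiv.Perm.mul_apply, ih, levelTwo_apply, wordBit, wordSec,
      wordBit_append, wordSec_append, wordPar_append, Bool.xor_assoc]

/-- In this quotient c agrees with b and d is trivial, so w becomes a product of the involutions a
and b. The hypotheses make its length odd, so it squares to 1. For the class ad this puts the
sections of the square into the case of weight 0. -/
theorem wordPar_isBD_wordSec_wordSec {w : List GrigLetter} (hw : wordPar isA w = true)
    (hw' : wordPar isBD w = wordPar isCD w) (ε δ : Bool) :
    wordPar isBD (wordSec (wordSec (w ++ w) ε) δ) = false := by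
  have ha : levelTwo a * levelTwo a = 1 := Equiv.ext (levelTwoFun_involutive a)
  have hb : levelTwo b * levelTwo b = 1 := Equiv.ext (levelTwoFun_involutive b)
  have hc : levelTwo c = levelTwo b := by
    ext ⟨ε, δ, s⟩ : 1
    cases ε <;> rfl
  have hd : levelTwo d = 1 := Equiv.ext fun _ => rfl
  have key : ∀ w : List GrigLetter, ∃ l : List (Equiv.Perm (Bool × Bool × Bool)),
      (∀ g ∈ l, g = levelTwo a ∨ g = levelTwo b) ∧ (w.map levelTwo).prod = l.prod ∧
        (Odd l.length ↔ xor (wordPar isA w) (xor (wordPar isBD w) (wordPar isCD w)) = true) := by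
    intro w
    induction w with
    | nil => exact ⟨[], by simp, by simp, by simp [wordPar]⟩
    | cons x w ih =>
      obtain ⟨l, h1, h2, h3⟩ := ih
      have hodd : ∀ g : Equiv.Perm (Bool × Bool × Bool), Odd (g :: l).length ↔
          xor true (xor (wordPar isA w) (xor (wordPar isBD w) (wordPar isCD w))) = true := by
        intro g
        rw [List.length_cons, Nat.odd_add_one, h3]
        simp
      cases x with
      | a =>
        refine ⟨levelTwo a :: l, ?_, ?_, ?_⟩
        · simpa using h1
        · simp [h2]
        · rw [hodd]; simp [wordPar, isA, isBD, isCD]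
      | b =>
        refine ⟨levelTwo b :: l, ?_, ?_, ?_⟩
        · simpa using h1
        · simp [h2]
        · rw [hodd]; simp [wordPar, isA, isBD, isCD]
      | c =>
        refine ⟨levelTwo b :: l, ?_, ?_, ?_⟩
        · simpa using h1
        · simp [h2, hc]
        · rw [hodd]; simp [wordPar, isA, isBD, isCD]
      | d =>
        refine ⟨l, h1, by simp [h2, hd], ?_⟩
        rw [h3]; simp [wordPar, isA, isBD, isCD]
  obtain ⟨l, h1, h2, h3⟩ := key w
  have h4 := list_prod_sq_of_involutions ha hb l h1 (h3.2 (by rw [hw, hw']; simp))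
  rw [← h2, ← List.prod_append, ← List.map_append] at h4
  have h5 := list_map_levelTwo_prod_apply (w ++ w) ε δ false
  rw [h4] at h5
  simpa using (congrArg (fun p => p.2.2) h5).symm

/-! ### Orders of elements -/

theorem wordAct_iterate_cons {w : List GrigLetter} (h : wordPar isA w = false) (n : ℕ) (ε : Bool)
    (v : List Bool) : (wordAct w)^[n] (ε :: v) = ε :: (wordAct (wordSec w ε))^[n] v := by
  induction n with
  | zero => rfl
  | succ n ih =>
    rw [Function.iterate_succ_apply', ih, wordAct_cons, wordBit_eq, h, Bool.false_xor,
      Function.iterate_succ_apply']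

theorem wordAct_iterate_nil (w : List GrigLetter) (n : ℕ) : (wordAct w)^[n] [] = [] :=
  Function.iterate_fixed (wordAct_nil w) n

theorem wordAct_iterate_pow_of_even {w : List GrigLetter} (h : wordPar isA w = false) {n : ℕ}
    (hs : ∀ ε v, (wordAct (wordSec w ε))^[n] v = v) (v : List Bool) : (wordAct w)^[n] v = v := by
  cases v with
  | nil => exact wordAct_iterate_nil w n
  | cons ε v => rw [wordAct_iterate_cons h, hs]

theorem wordAct_iterate_pow_of_odd {w : List GrigLetter} (h : wordPar isA w = true) {n : ℕ}
    (hs : ∀ ε v, (wordAct (wordSec (w ++ w) ε))^[n] v = v) (v : List Bool) :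
    (wordAct w)^[2 * n] v = v := by
  have h2 : (wordAct w)^[2] = wordAct (w ++ w) := by
    funext u
    rw [wordAct_append]
    rfl
  rw [Function.iterate_mul, h2]
  refine wordAct_iterate_pow_of_even ?_ hs v
  rw [wordPar_append, h]
  rfl

/-- A bound for the order of the element represented by a word, in terms of its class modulo the
commutator subgroup and of its sections. -/
def torsionWeight (w : List GrigLetter) : ℕ :=
  -- The classes are, in order, a, ab, ac, ad, 1, c, d, b. The class b is split: weight 0 requires
  -- that no section has class ab, the class of weight 6.
  match wordPar isA w, wordPar isBD w, wordPar isCD w with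
  | true, false, false => 3
  | true, true, false => 6
  | true, false, true => 4
  | true, true, true => 2
  | false, false, false => 1
  | false, false, true => 3
  | false, true, true => 1
  | false, true, false =>
    if wordPar isBD (wordSec w false) = false ∧ wordPar isBD (wordSec w true) = false then 0 else 3

theorem torsionWeight_reduceWord (w : List GrigLetter) :
    torsionWeight (reduceWord w) = torsionWeight w := by
  simp only [torsionWeight, wordPar_isBD_wordSec_reduceWord, wordPar_reduceWord (f := isA) (by simp),
    wordPar_reduceWord (f := isBD) (by simp), wordPar_reduceWord (f := isCD) (by simp)]

/-- Sections of the classes 1 and d lie in 1, b, ac, ad, of weight at most 4; sections of b and c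
lie in a, ab, c, d, of weight at most 6. In the case of weight 0 only a and c remain, of weight 3.
-/
theorem torsionWeight_wordSec_le {w : List GrigLetter} (h : wordPar isA w = false) (ε : Bool) :
    torsionWeight (wordSec w ε) ≤ torsionWeight w + 3 := by
  have h1 : xor (wordPar isA (wordSec w ε)) (wordPar isCD (wordSec w ε)) =
      xor (wordPar isBD w) (wordPar isCD w) := by
    rw [← wordPar_xor, ← wordPar_xor]
    refine wordPar_wordSec (fun x ε => ?_) w ε
    cases x <;> cases ε <;> rfl
  have h2 : ∀ P : Prop, [Decidable P] → (if P then 0 else 3) ≤ 3 := fun P _ => by split <;> omega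
  have h3 : wordPar isBD (wordSec w false) = false ∧ wordPar isBD (wordSec w true) = false →
      wordPar isBD (wordSec w ε) = false := by
    rintro ⟨h, h'⟩
    cases ε <;> assumption
  unfold torsionWeight
  rw [h]
  revert h1 h3
  cases wordPar isA (wordSec w ε) <;> cases wordPar isBD (wordSec w ε) <;>
    cases wordPar isCD (wordSec w ε) <;> cases wordPar isBD w <;> cases wordPar isCD w <;>
    intro h1 h3 <;> simp at h1 h3 ⊢ <;> first
      | omega
      | (split <;> omega)
      | (split <;> simp_all)

/-- Sections of squares change the class by ab → ac → ad → b and a → 1, with weights 6, 4, 2, 0 and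
3, 1. -/
theorem torsionWeight_wordSec_append_self_le {w : List GrigLetter} (h : wordPar isA w = true)
    (ε : Bool) : torsionWeight (wordSec (w ++ w) ε) + 2 ≤ torsionWeight w := by
  have hα := wordPar_wordSec_append_self (f := isA) (g := fun x => xor (isBD x) (isCD x))
    (fun x => by cases x <;> rfl) h ε
  have hβ := wordPar_wordSec_append_self (f := isBD) (g := isCD) (fun x => by cases x <;> rfl) h ε
  have hγ := wordPar_wordSec_append_self (f := isCD) (g := fun x => xor (isBD x) (isCD x))
    (fun x => by cases x <;> rfl) h ε
  have hq := fun hw δ => wordPar_isBD_wordSec_wordSec h hw ε δ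
  rw [wordPar_xor] at hα hγ
  unfold torsionWeight
  rw [hα, hβ, hγ, h]
  revert hq
  cases wordPar isBD w <;> cases wordPar isCD w <;> simp +contextual

/-- A certificate that the element represented by a word has order dividing `2 ^ e`. -/
def torsionCheck : ℕ → ℕ → List GrigLetter → Bool
  | _, _, [] => true
  | _, _ + 1, [_] => true
  | n + 1, e + 1, x :: y :: w =>
    if wordPar isA (x :: y :: w) then
      torsionCheck n e (wordSec (x :: y :: w ++ x :: y :: w) false) &&
        torsionCheck n e (wordSec (x :: y :: w ++ x :: y :: w) true)
    else
      torsionCheck n (e + 1) (wordSec (x :: y :: w) false) &&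
        torsionCheck n (e + 1) (wordSec (x :: y :: w) true)
  | _, _, _ => false

theorem wordAct_iterate_of_torsionCheck (n e : ℕ) (w : List GrigLetter)
    (h : torsionCheck n e w = true) (v : List Bool) : (wordAct w)^[2 ^ e] v = v := by
  induction n, e, w using torsionCheck.induct generalizing v with
  | case1 => exact Function.iterate_fixed rfl _
  | case2 n e x =>
    rw [pow_succ', Function.iterate_mul]
    have h' : (wordAct [x])^[2] = id := funext x.act_involutive
    rw [h', Function.iterate_id, id]
  | case3 n e x y w hw ih1 ih2 =>
    rw [torsionCheck, if_pos hw, Bool.and_eq_true] at h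
    rw [pow_succ']
    refine wordAct_iterate_pow_of_odd hw (fun ε v => ?_) v
    cases ε
    · exact ih1 h.1 v
    · exact ih2 h.2 v
  | case4 n e x y w hw ih1 ih2 =>
    rw [torsionCheck, if_neg hw, Bool.and_eq_true] at h
    refine wordAct_iterate_pow_of_even (by simpa using hw) (fun ε v => ?_) v
    cases ε
    · exact ih1 h.1 v
    · exact ih2 h.2 v
  | case5 => simp_all [torsionCheck]

/-- Words with at most one letter different from `a` represent elements of order at most `16`. -/
theorem wordAct_iterate_sixteen {w : List GrigLetter} (hw : IsAlternating w) (hx : xcount w ≤ 1)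
    (v : List Bool) : (wordAct w)^[16] v = v := by
  -- Recursion depth 6 and exponent 4 suffice for these finitely many words; ab has order 16.
  refine wordAct_iterate_of_torsionCheck 6 4 w ?_ v
  match w with
  | [] => rfl
  | [x] => rfl
  | [x, y] => cases x <;> cases y <;> simp_all [IsAlternating, xcount, merge] <;> rfl
  | [x, y, z] =>
    cases x <;> cases y <;> cases z <;> simp_all [IsAlternating, xcount, merge] <;> rfl
  | x :: y :: z :: t :: w =>
    cases x <;> cases y <;> cases z <;> cases t <;> simp_all [IsAlternating, xcount, merge]

/-- Amortization: halving lowers 3i by 3 and raises the weight by at most 3; squaring lowers 2e by 2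
and the weight by at least 2. The 8 leaves exponent 4 for the base case. -/
theorem wordAct_iterate_two_pow (i e : ℕ) (w : List GrigLetter) (hi : xcount w ≤ 2 ^ i)
    (he : 3 * i + torsionWeight w + 8 ≤ 2 * e) (v : List Bool) :
    (wordAct w)^[2 ^ e] v = v := by
  have hred : ∀ w, wordAct (reduceWord w) = wordAct w := fun w => funext (wordAct_reduceWord w)
  induction i generalizing e w v with
  | zero =>
    rw [← hred]
    have h := wordAct_iterate_sixteen (isAlternating_reduceWord w)
      ((xcount_reduceWord_le w).trans hi)
    obtain ⟨k, rfl⟩ : ∃ k, e = 4 + k := ⟨e - 4, by omega⟩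
    rw [pow_add, Function.iterate_mul]
    have h' : (wordAct (reduceWord w))^[2 ^ 4] = id := funext h
    rw [h', Function.iterate_id, id]
  | succ i ih =>
    induction e generalizing w v with
    | zero => omega
    | succ e ihe =>
      rw [← hred]
      have hx := (xcount_reduceWord_le w).trans hi
      rw [← torsionWeight_reduceWord] at he
      have hw := isAlternating_reduceWord w
      generalize reduceWord w = u at hx he hw
      cases hu : wordPar isA u with
      | false =>
        refine wordAct_iterate_pow_of_even hu (fun ε => ih _ _ ?_ ?_) v
        -- The bound 2x ≤ 2^(i+1) + 1 gives x ≤ 2^i by parity.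
        · have := two_mul_xcount_wordSec_le hw ε
          rw [pow_succ] at hx
          omega
        · have := torsionWeight_wordSec_le hu ε
          omega
      | true =>
        rw [pow_succ']
        refine wordAct_iterate_pow_of_odd hu (fun ε => ihe _ ?_ ?_) v
        · rw [wordSec_append_self hu, xcount_append, xcount_wordSec]
          exact hx
        · have := torsionWeight_wordSec_append_self_le hu ε
          omega

/-! ### Elements of rigid stabilizers -/

theorem wordAct_append_reverse (w : List GrigLetter) (v : List Bool) :
    wordAct (w ++ w.reverse) v = v := by
  induction w generalizing v with
  | nil => rfl
  | cons x w ih =>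
    rw [List.reverse_cons, List.cons_append, ← List.append_assoc, wordAct, wordAct_append, ih]
    exact x.act_involutive v

/-- The value of the substitution `a ↦ aca`, `b ↦ d`, `c ↦ b`, `d ↦ c` at a letter. -/
def GrigLetter.lysenok : GrigLetter → List GrigLetter
  | a => [a, c, a]
  | b => [d]
  | c => [b]
  | d => [c]

/-- The section of `GrigLetter.lysenok x` at the vertex `0`. -/
def GrigLetter.lysenokSec : GrigLetter → List GrigLetter
  | a => [d]
  | b => []
  | c => [a]
  | d => [a]

/-- The substitution `a ↦ aca`, `b ↦ d`, `c ↦ b`, `d ↦ c`. -/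
def lysenokSubst (w : List GrigLetter) : List GrigLetter := w.flatMap lysenok

/-- The section of `lysenokSubst w` at the vertex `0`. -/
def substSec (w : List GrigLetter) : List GrigLetter := w.flatMap GrigLetter.lysenokSec

/-- Letterwise: aca = (d,a), d = (1,b), b = (a,c), c = (a,d). -/
theorem wordAct_lysenokSubst (w : List GrigLetter) (v : List Bool) :
    wordAct (lysenokSubst w) (true :: v) = true :: wordAct w v ∧
      wordAct (lysenokSubst w) (false :: v) = false :: wordAct (substSec w) v := by
  induction w with
  | nil => exact ⟨rfl, rfl⟩
  | cons x w ih =>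
    simp only [lysenokSubst, substSec, List.flatMap_cons, wordAct_append] at ih ⊢
    rw [ih.1, ih.2]
    cases x <;> simp [lysenok, GrigLetter.lysenokSec, wordAct, act, actA, actB, actC, actD]

theorem length_lysenokSubst_le (w : List GrigLetter) :
    (lysenokSubst w).length ≤ 3 * w.length := by
  induction w with
  | nil => simp [lysenokSubst]
  | cons x w ih =>
    rw [lysenokSubst] at ih ⊢
    rw [List.flatMap_cons, List.length_append, List.length_cons]
    have : x.lysenok.length ≤ 3 := by cases x <;> simp [lysenok]
    omega

theorem lysenokSubst_append (w u : List GrigLetter) :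
    lysenokSubst (w ++ u) = lysenokSubst w ++ lysenokSubst u := by
  simp [lysenokSubst]

theorem lysenokSubst_iterate_append (j : ℕ) (w u : List GrigLetter) :
    lysenokSubst^[j] (w ++ u) = lysenokSubst^[j] w ++ lysenokSubst^[j] u := by
  induction j generalizing w u with
  | zero => rfl
  | succ j ih => rw [Function.iterate_succ_apply, lysenokSubst_append, ih]; rfl

theorem substSec_append (w u : List GrigLetter) :
    substSec (w ++ u) = substSec w ++ substSec u := by
  simp [substSec]

theorem lysenokSubst_reverse (w : List GrigLetter) :
    (lysenokSubst w).reverse = lysenokSubst w.reverse := by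
  induction w with
  | nil => rfl
  | cons x w ih =>
    rw [List.reverse_cons, lysenokSubst_append, ← ih]
    cases x <;> simp [lysenokSubst, lysenok]

theorem lysenokSubst_iterate_reverse (j : ℕ) (w : List GrigLetter) :
    (lysenokSubst^[j] w).reverse = lysenokSubst^[j] w.reverse := by
  induction j generalizing w with
  | zero => rfl
  | succ j ih => rw [Function.iterate_succ_apply, ih, lysenokSubst_reverse]; rfl

theorem substSec_reverse (w : List GrigLetter) :
    (substSec w).reverse = substSec w.reverse := by
  induction w with
  | nil => rfl
  | cons x w ih =>
    rw [List.reverse_cons, substSec_append, ← ih]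
    cases x <;> simp [substSec, GrigLetter.lysenokSec]

/-- All images of the word under iterates of the substitution act trivially below the vertex `0`. -/
def IsLysenokTrivial (w : List GrigLetter) : Prop :=
  ∀ (j : ℕ) (v : List Bool), wordAct (substSec (lysenokSubst^[j] w)) v = v

theorem IsLysenokTrivial.subst {w : List GrigLetter} (h : IsLysenokTrivial w) :
    IsLysenokTrivial (lysenokSubst w) := fun j v => by
  rw [← Function.iterate_succ_apply]
  exact h (j + 1) v

/-- Iterated images of a are palindromes, and so are their sections at 0; these are involutions, and
conjugation by them preserves triviality. -/
theorem IsLysenokTrivial.conj {w : List GrigLetter} (h : IsLysenokTrivial w) :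
    IsLysenokTrivial ([a] ++ w ++ [a]) := fun j v => by
  have h1 := lysenokSubst_iterate_reverse j [a]
  have h2 := substSec_reverse (lysenokSubst^[j] [a])
  rw [h1, List.reverse_singleton] at h2
  rw [lysenokSubst_iterate_append, lysenokSubst_iterate_append, substSec_append,
    substSec_append, wordAct_append, wordAct_append, h j]
  nth_rw 2 [← h2]
  rw [← wordAct_append, wordAct_append_reverse]

/-- After two substitutions the letters a, b, c, d have sections dad·dad = 1, a, a, 1 at the vertex
0. -/
theorem wordAct_substSec_lysenokSubst_lysenokSubst (w : List GrigLetter) :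
    (∀ v, wordAct (substSec (lysenokSubst (lysenokSubst w))) v = v) ∨
      ∀ v, wordAct (substSec (lysenokSubst (lysenokSubst w))) v = actA v := by
  induction w with
  | nil => exact Or.inl fun _ => rfl
  | cons x w ih =>
    have hx : (∀ v, wordAct (substSec (lysenokSubst (lysenokSubst [x]))) v = v) ∨
        ∀ v, wordAct (substSec (lysenokSubst (lysenokSubst [x]))) v = actA v := by
      have hd := fun v => (actBCD_involutive v).2.2
      cases x
      · exact Or.inl fun v => by
          simp [substSec, lysenokSubst, lysenok, GrigLetter.lysenokSec, wordAct, act, hd,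
            actA_involutive _]
      · exact Or.inr fun v => rfl
      · exact Or.inr fun v => rfl
      · exact Or.inl fun v => rfl
    rw [← List.singleton_append, lysenokSubst_append, lysenokSubst_append, substSec_append]
    simp only [wordAct_append]
    rcases hx with hx | hx <;> rcases ih with ih | ih <;> simp [hx, ih, actA_involutive _]

/-- The sections at 0 are dd, then (da)^4, then squares in {1, a}. -/
theorem isLysenokTrivial_abab : IsLysenokTrivial [a, b, a, b] := fun j v => by
  match j with
  | 0 => exact (actBCD_involutive v).2.2
  | 1 => exact wordAct_iterate_of_torsionCheck 6 2 [d, a] rfl v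
  | j + 2 =>
    have h : lysenokSubst^[j + 2] [a, b, a, b] =
        lysenokSubst (lysenokSubst (lysenokSubst^[j] [a, b])) ++
          lysenokSubst (lysenokSubst (lysenokSubst^[j] [a, b])) := by
      rw [← lysenokSubst_append, ← lysenokSubst_append, ← lysenokSubst_iterate_append,
        Function.iterate_succ_apply', Function.iterate_succ_apply']
      rfl
    rw [h, substSec_append, wordAct_append]
    rcases wordAct_substSec_lysenokSubst_lysenokSubst (lysenokSubst^[j] [a, b]) with h | h
    · rw [h, h]
    · rw [h, h, actA_involutive]

/-- The rigid stabilizer of a vertex `q` contains an element that acts as `abab` on the subtree below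
`q`, and it is represented by a word whose length is at most exponential in the level of `q`. -/
theorem exists_rigid_word (q : List Bool) : ∃ w : List GrigLetter,
    w.length + 1 ≤ 9 * 3 ^ q.length ∧
      (∀ v, wordAct w (q ++ v) = q ++ wordAct [a, b, a, b] v) ∧
        ∀ u, ¬ q <+: u → wordAct w u = u := by
  suffices h : ∃ w : List GrigLetter, IsLysenokTrivial w ∧ w.length + 1 ≤ 9 * 3 ^ q.length ∧
      (∀ v, wordAct w (q ++ v) = q ++ wordAct [a, b, a, b] v) ∧
        ∀ u, ¬ q <+: u → wordAct w u = u from h.imp fun w h => h.2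
  induction q with
  | nil => exact ⟨[a, b, a, b], isLysenokTrivial_abab, by simp, fun v => rfl, by simp⟩
  | cons ε q ih =>
    obtain ⟨w, hw, hl, h1, h2⟩ := ih
    -- Conjugation by a adds 2 to a length that was tripled; the +1 in the bound absorbs this, as 3L
    -- + 2 + 1 = 3(L + 1).
    have hl' := length_lysenokSubst_le w
    rw [List.length_cons, pow_succ]
    cases ε with
    | true =>
      refine ⟨lysenokSubst w, hw.subst, by omega, fun v => ?_, fun u hu => ?_⟩
      · rw [List.cons_append, (wordAct_lysenokSubst w _).1, h1, List.cons_append]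
      · match u with
        | [] => exact wordAct_nil _
        | false :: u => rw [(wordAct_lysenokSubst w u).2, show wordAct (substSec w) u = u from hw 0 u]
        | true :: u =>
          rw [(wordAct_lysenokSubst w u).1, h2]
          simpa using hu
    | false =>
      have hA : ∀ ε v, wordAct ([a] ++ lysenokSubst w ++ [a]) (ε :: v) =
          actA (wordAct (lysenokSubst w) ((!ε) :: v)) := fun ε v => by
        rw [wordAct_append, wordAct_append]; rfl
      refine ⟨[a] ++ lysenokSubst w ++ [a], hw.subst.conj, ?_, fun v => ?_, fun u hu => ?_⟩
      · simp only [List.length_append, List.length_singleton]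
        omega
      · rw [List.cons_append (as := q), hA, Bool.not_false, (wordAct_lysenokSubst w _).1, h1,
          List.cons_append]
        rfl
      · match u with
        | [] => exact wordAct_nil _
        | true :: u =>
          rw [hA, Bool.not_true, (wordAct_lysenokSubst w u).2,
            show wordAct (substSec w) u = u from hw 0 u]
          rfl
        | false :: u =>
          rw [hA, Bool.not_false, (wordAct_lysenokSubst w u).1, h2]
          · rfl
          · simpa using hu

/-! ### The element represented by a word -/

/-- The element of the Grigorchuk group represented by a letter. -/
def GrigLetter.toGroup : GrigLetter → grigorchukGroup
  | a => ⟨grigA, Subgroup.subset_closure (by simp)⟩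
  | b => ⟨grigB, Subgroup.subset_closure (by simp)⟩
  | c => ⟨grigC, Subgroup.subset_closure (by simp)⟩
  | d => ⟨grigD, Subgroup.subset_closure (by simp)⟩

/-- The element of the Grigorchuk group represented by a word. -/
def wordElt (w : List GrigLetter) : grigorchukGroup := (w.map toGroup).prod

theorem wordElt_append (w u : List GrigLetter) : wordElt (w ++ u) = wordElt w * wordElt u := by
  simp [wordElt]

theorem wordElt_apply (w : List GrigLetter) (v : List Bool) :
    (wordElt w : binaryTree ≃g binaryTree) v = wordAct w v := by
  induction w with
  | nil => rfl
  | cons x w ih =>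
    rw [wordElt, List.map_cons, List.prod_cons, wordAct, ← ih]
    cases x <;> rfl

theorem grigorchukGroup_ext {g h : grigorchukGroup}
    (H : ∀ v, (g : binaryTree ≃g binaryTree) v = (h : binaryTree ≃g binaryTree) v) : g = h :=
  Subtype.ext (RelIso.ext H)

theorem wordElt_reverse (w : List GrigLetter) : wordElt w.reverse = (wordElt w)⁻¹ := by
  rw [eq_comm, inv_eq_iff_mul_eq_one, ← wordElt_append]
  exact grigorchukGroup_ext fun v => by rw [wordElt_apply, wordAct_append_reverse]; rfl

theorem wordElt_surjective : Function.Surjective wordElt := by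
  rintro ⟨g, hg⟩
  induction hg using Subgroup.closure_induction with
  | mem x hx =>
    rcases hx with rfl | rfl | rfl | rfl
    · exact ⟨[a], mul_one _⟩
    · exact ⟨[b], mul_one _⟩
    · exact ⟨[c], mul_one _⟩
    · exact ⟨[d], mul_one _⟩
  | one => exact ⟨[], rfl⟩
  | mul x y hx hy ihx ihy =>
    obtain ⟨w, hw⟩ := ihx
    obtain ⟨u, hu⟩ := ihy
    exact ⟨w ++ u, by rw [wordElt_append, hw, hu]; rfl⟩
  | inv x hx ih =>
    obtain ⟨w, hw⟩ := ih
    exact ⟨w.reverse, by rw [wordElt_reverse, hw]; rfl⟩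

theorem wordElt_pow_apply (w : List GrigLetter) (n : ℕ) (v : List Bool) :
    ((wordElt w ^ n : grigorchukGroup) : binaryTree ≃g binaryTree) v = (wordAct w)^[n] v := by
  induction n with
  | zero => rfl
  | succ n ih =>
    rw [pow_succ', Function.iterate_succ_apply', ← ih, ← wordElt_apply]
    rfl

theorem exists_wordAct_append (w : List GrigLetter) (v x : List Bool) :
    ∃ y, y.length = x.length ∧ wordAct w (v ++ x) = wordAct w v ++ y := by
  have hlen : ∀ (v : List Bool) (w), (wordAct w v).length = v.length := by
    intro v
    induction v with
    | nil => exact fun w => by rw [wordAct_nil]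
    | cons ε v ih => exact fun w => by rw [wordAct_cons, List.length_cons, ih, List.length_cons]
  induction v generalizing w with
  | nil => exact ⟨wordAct w x, hlen _ _, by rw [wordAct_nil]; rfl⟩
  | cons ε v ih =>
    obtain ⟨y, h1, h2⟩ := ih (wordSec w ε)
    exact ⟨y, h1, by rw [List.cons_append, wordAct_cons, h2, wordAct_cons, List.cons_append]⟩

theorem length_wordAct (w : List GrigLetter) (v : List Bool) :
    (wordAct w v).length = v.length := by
  obtain ⟨y, h1, h2⟩ := exists_wordAct_append w [] v
  rw [wordAct_nil] at h2
  simpa [h1] using congrArg List.length h2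

/-! ### Word length -/

section WordLength

variable {G : Type*} [Group G] {S : Set G}

theorem wordLength_le {l : List G} (hl : ∀ x ∈ l, x ∈ S ∨ x⁻¹ ∈ S) :
    wordLength S l.prod ≤ l.length :=
  Nat.sInf_le ⟨l, hl, rfl, rfl⟩

theorem exists_list_wordLength (hS : Subgroup.closure S = ⊤) (g : G) :
    ∃ l : List G, (∀ x ∈ l, x ∈ S ∨ x⁻¹ ∈ S) ∧ l.prod = g ∧ l.length = wordLength S g := by
  have hg : g ∈ (Subgroup.closure S).toSubmonoid := hS ▸ Subgroup.mem_top g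
  rw [Subgroup.closure_toSubmonoid] at hg
  obtain ⟨l, hl, h⟩ := Submonoid.exists_list_of_mem_closure hg
  exact Nat.sInf_mem (s := {n : ℕ | ∃ l : List G, (∀ x ∈ l, x ∈ S ∨ x⁻¹ ∈ S) ∧ l.prod = g ∧
    l.length = n}) ⟨l.length, l, hl, h, rfl⟩

theorem wordLength_mul_le (hS : Subgroup.closure S = ⊤) (g h : G) :
    wordLength S (g * h) ≤ wordLength S g + wordLength S h := by
  obtain ⟨l, hl, rfl, hl'⟩ := exists_list_wordLength hS g
  obtain ⟨m, hm, rfl, hm'⟩ := exists_list_wordLength hS h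
  rw [← hl', ← hm', ← List.length_append, ← List.prod_append]
  exact wordLength_le fun x hx => (List.mem_append.1 hx).elim (hl x) (hm x)

theorem wordLength_one : wordLength S (1 : G) = 0 :=
  Nat.le_zero.1 (wordLength_le (S := S) (l := []) (by simp))

theorem one_le_wordLength (hS : Subgroup.closure S = ⊤) {g : G} (hg : g ≠ 1) :
    1 ≤ wordLength S g := by
  obtain ⟨l, -, rfl, hl⟩ := exists_list_wordLength hS g
  rw [← hl, Nat.one_le_iff_ne_zero]
  rintro h
  rw [List.length_eq_zero_iff] at h
  simp [h] at hg

end WordLength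

section GrigorchukGenerators

variable {S : Set grigorchukGroup}

/-- The word length with respect to `S` is at most linear in the length of words in `a, b, c, d`. -/
theorem exists_wordLength_wordElt_le (hS : Subgroup.closure S = ⊤) :
    ∃ D : ℕ, ∀ w, wordLength S (wordElt w) ≤ D * w.length := by
  refine ⟨wordLength S (toGroup a) + wordLength S (toGroup b) + wordLength S (toGroup c) +
    wordLength S (toGroup d), fun w => ?_⟩
  induction w with
  | nil => exact wordLength_one.le
  | cons x w ih =>
    refine (wordLength_mul_le hS x.toGroup (wordElt w)).trans ?_
    rw [List.length_cons, mul_add_one, add_comm]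
    refine add_le_add ih ?_
    cases x <;> omega

/-- Every element is represented by a word in `a, b, c, d` whose length is at most linear in the word
length with respect to `S`. -/
theorem exists_wordElt_eq (hfin : S.Finite) (hS : Subgroup.closure S = ⊤) :
    ∃ D : ℕ, 0 < D ∧ ∀ g, ∃ w, wordElt w = g ∧ w.length ≤ D * wordLength S g := by
  choose f hf using wordElt_surjective
  obtain ⟨D, hD⟩ := ((hfin.union hfin.inv).image fun g => (f g).length).bddAbove
  refine ⟨D + 1, D.succ_pos, fun g => ?_⟩
  obtain ⟨l, hl, rfl, hl'⟩ := exists_list_wordLength hS g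
  rw [← hl']
  clear hl'
  induction l with
  | nil => exact ⟨[], rfl, by simp⟩
  | cons x l ih =>
    obtain ⟨w, h1, h2⟩ := ih fun y hy => hl y (List.mem_cons_of_mem _ hy)
    refine ⟨f x ++ w, by rw [wordElt_append, hf, h1, List.prod_cons], ?_⟩
    have h3 : (f x).length ≤ D := hD ⟨x, hl x List.mem_cons_self, rfl⟩
    rw [List.length_append, List.length_cons, mul_add_one]
    omega

end GrigorchukGenerators

/-! ### Trajectories -/

/-- The word in `a, b, c, d` substituted for a letter of a word in the free group. -/
def substLetter {k : ℕ} (f : Fin k → List GrigLetter) (s : Fin k × Bool) : List GrigLetter :=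
  cond s.2 (f s.1) (f s.1).reverse

/-- The image of a vertex under the value of a word in the free group. -/
def trajPoint {k : ℕ} (f : Fin k → List GrigLetter) (v : List Bool) :
    List (Fin k × Bool) → List Bool
  | [] => v
  | s :: l => wordAct (substLetter f s) (trajPoint f v l)

theorem wordAct_substLetter_not {k : ℕ} (f : Fin k → List GrigLetter) (i : Fin k) (ε : Bool)
    (u : List Bool) : wordAct (substLetter f (i, !ε)) (wordAct (substLetter f (i, ε)) u) = u := by
  rw [← wordAct_append]
  cases ε
  · exact wordAct_append_reverse (f i) u
  · have h := wordAct_append_reverse (f i).reverse u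
    rwa [List.reverse_reverse] at h

theorem lift_mk_apply {k : ℕ} (f : Fin k → List GrigLetter) (l : List (Fin k × Bool))
    (v : List Bool) :
    ((FreeGroup.lift (fun i => wordElt (f i)) (FreeGroup.mk l) : grigorchukGroup) :
      binaryTree ≃g binaryTree) v = trajPoint f v l := by
  induction l with
  | nil => rfl
  | cons s l ih =>
    rw [FreeGroup.lift_mk] at ih ⊢
    rw [List.map_cons, List.prod_cons, trajPoint, ← ih, ← wordElt_apply]
    have h : cond s.2 (wordElt (f s.1)) (wordElt (f s.1))⁻¹ = wordElt (substLetter f s) := by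
      rw [← wordElt_reverse, substLetter]
      cases s.2 <;> rfl
    rw [h]
    rfl

theorem length_trajPoint {k : ℕ} (f : Fin k → List GrigLetter) (v : List Bool)
    (l : List (Fin k × Bool)) : (trajPoint f v l).length = v.length := by
  induction l with
  | nil => rfl
  | cons s l ih => rw [trajPoint, length_wordAct, ih]

theorem exists_trajPoint_append {k : ℕ} (f : Fin k → List GrigLetter) (v x : List Bool)
    (l : List (Fin k × Bool)) :
    ∃ y, y.length = x.length ∧ trajPoint f (v ++ x) l = trajPoint f v l ++ y := by
  induction l with
  | nil => exact ⟨x, rfl, rfl⟩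
  | cons s l ih =>
    obtain ⟨y, h1, h2⟩ := ih
    obtain ⟨z, h3, h4⟩ := exists_wordAct_append (substLetter f s) (trajPoint f v l) y
    exact ⟨z, h3.trans h1, by rw [trajPoint, h2, h4, trajPoint]⟩

/-- The images of the vertex under the values of all suffixes of the word are distinct. -/
def IsFreeTraj {k : ℕ} (f : Fin k → List GrigLetter) (v : List Bool) (l : List (Fin k × Bool)) :
    Prop :=
  ∀ l₁ l₂, l₁ <:+ l → l₂ <:+ l → trajPoint f v l₁ = trajPoint f v l₂ → l₁ = l₂

theorem isFreeTraj_cons {k : ℕ} {f : Fin k → List GrigLetter} {v : List Bool}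
    {l : List (Fin k × Bool)} {s : Fin k × Bool} (h : IsFreeTraj f v l)
    (hs : ∀ m, m <:+ l → trajPoint f v m ≠ trajPoint f v (s :: l)) : IsFreeTraj f v (s :: l) := by
  intro l₁ l₂ h1 h2 h12
  rw [List.suffix_cons_iff] at h1 h2
  rcases h1 with rfl | h1 <;> rcases h2 with rfl | h2
  · rfl
  · exact absurd h12.symm (hs _ h2)
  · exact absurd h12 (hs _ h1)
  · exact h _ _ h1 h2 h12

theorem IsFreeTraj.append {k : ℕ} {f : Fin k → List GrigLetter} {v : List Bool}
    {l : List (Fin k × Bool)} (h : IsFreeTraj f v l) (x : List Bool) :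
    IsFreeTraj f (v ++ x) l := by
  intro l₁ l₂ h1 h2 h12
  obtain ⟨y, hy, hy'⟩ := exists_trajPoint_append f v x l₁
  obtain ⟨z, hz, hz'⟩ := exists_trajPoint_append f v x l₂
  rw [hy', hz'] at h12
  exact h _ _ h1 h2 (List.append_inj_left h12 (by rw [length_trajPoint, length_trajPoint]))

/-- On the second level abab changes the second letter. This is why vertices are extended by two
letters. -/
theorem wordAct_abab_ne {z : List Bool} (hz : z.length = 2) : wordAct [a, b, a, b] z ≠ z := by
  match z, hz with
  | [x, y], _ => cases x <;> cases y <;> decide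

/-- Extension of a tuple with a trajectory without repetitions to a longer word. -/
theorem exists_isFreeTraj_cons {k : ℕ} {f : Fin k → List GrigLetter} {v : List Bool}
    {l : List (Fin k × Bool)} {s : Fin k × Bool} (h : IsFreeTraj f v l)
    (hred : FreeGroup.IsReduced (s :: l)) :
    ∃ f' : Fin k → List GrigLetter,
      ∑ i, (f' i).length ≤ ∑ i, (f i).length + 9 * 3 ^ v.length ∧
        IsFreeTraj f' (v ++ [false, false]) (s :: l) := by
  have hx := h.append [false, false]
  by_cases hs : ∀ m, m <:+ l → trajPoint f (v ++ [false, false]) m ≠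
      trajPoint f (v ++ [false, false]) (s :: l)
  · exact ⟨f, Nat.le_add_right _ _, isFreeTraj_cons hx hs⟩
  push Not at hs
  obtain ⟨m₀, hm₀, hm₀'⟩ := hs
  obtain ⟨i, ε⟩ := s
  obtain ⟨w, hlen, hw, hw'⟩ := exists_rigid_word (trajPoint f v ((i, ε) :: l))
  rw [length_trajPoint] at hlen
  generalize hq : trajPoint f v ((i, ε) :: l) = q at hw hw'
  have hqlen : q.length = v.length := hq ▸ length_trajPoint f v _
  -- Chosen so that the letter (i, ε), whatever its sign, acts as before followed by w.
  let f' : Fin k → List GrigLetter :=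
    Function.update f i (cond ε (w ++ f i) (f i ++ w.reverse))
  have hsame : ∀ u, wordAct (substLetter f' (i, ε)) u =
      wordAct w (wordAct (substLetter f (i, ε)) u) := by
    intro u
    rw [← wordAct_append]
    cases ε <;> simp [f', substLetter]
  have hinv : ∀ u, wordAct (substLetter f' (i, !ε)) u =
      wordAct (substLetter f (i, !ε)) (wordAct w.reverse u) := by
    intro u
    rw [← wordAct_append]
    cases ε <;> simp [f', substLetter]
  have hother : ∀ j δ, j ≠ i → substLetter f' (j, δ) = substLetter f (j, δ) := by
    intro j δ hj
    simp [f', substLetter, Function.update_of_ne hj]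
  have hrev : ∀ u, ¬ q <+: u → wordAct w.reverse u = u := by
    intro u hu
    have h1 := wordAct_append_reverse w.reverse u
    rwa [List.reverse_reverse, wordAct_append, hw' u hu] at h1
  have hprefix : ∀ m, q <+: trajPoint f (v ++ [false, false]) m ↔ trajPoint f v m = q := by
    intro m
    obtain ⟨y, -, hy⟩ := exists_trajPoint_append f v [false, false] m
    rw [hy]
    refine ⟨fun hp => ?_, fun hp => hp ▸ List.prefix_append _ _⟩
    refine ((List.prefix_of_prefix_length_le hp (List.prefix_append _ y)
      (by rw [hqlen, length_trajPoint])).eq_of_length (by rw [hqlen, length_trajPoint])).symm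
  have htraj : ∀ m, m <:+ l → trajPoint f' (v ++ [false, false]) m =
      trajPoint f (v ++ [false, false]) m := by
    intro m hm
    induction m with
    | nil => rfl
    | cons t m ih =>
      have hm' : m <:+ l := (List.suffix_cons t m).trans hm
      obtain ⟨j, δ⟩ := t
      rw [trajPoint, trajPoint, ih hm']
      by_cases hj : j = i
      · subst hj
        by_cases hδ : δ = ε
        · subst hδ
          rw [hsame]
          -- If the image lay below q, injectivity of the letter and freeness at v would give m = l,
          -- although m is a proper suffix.
          refine hw' _ fun hp => ?_
          have h1 := (hprefix ((j, δ) :: m)).1 hp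
          rw [← hq, trajPoint, trajPoint] at h1
          have h2 := congrArg (wordAct (substLetter f (j, !δ))) h1
          rw [wordAct_substLetter_not, wordAct_substLetter_not] at h2
          have h3 := h _ _ hm' List.suffix_rfl h2
          subst h3
          have h4 := hm.length_le
          simp at h4
        · obtain rfl : δ = !ε := by cases δ <;> cases ε <;> simp_all
          rw [hinv]
          congr 1
          -- If this point lay below q, the inverse letter would lead to the endpoint of l. By
          -- freeness l would then start with the inverse of the added letter, against reducedness.
          refine hrev _ fun hp => ?_
          have h1 := (hprefix m).1 hp
          have h2 : trajPoint f v ((j, !ε) :: m) = trajPoint f v l := by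
            rw [trajPoint, h1, ← hq, trajPoint, wordAct_substLetter_not]
          have h3 := h _ _ hm List.suffix_rfl h2
          rw [← h3, FreeGroup.IsReduced, List.isChain_cons_cons] at hred
          simpa using hred.1 rfl
      · rw [hother j δ hj]
  refine ⟨f', ?_, isFreeTraj_cons (fun l₁ l₂ h1 h2 h12 => ?_) fun m hm hm' => ?_⟩
  · have h1 : ∑ j, (f' j).length ≤ ∑ j, ((f j).length + if j = i then w.length else 0) := by
      refine Finset.sum_le_sum fun j _ => ?_
      by_cases hj : j = i
      · subst hj
        cases ε <;> simp [f', add_comm]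
      · simp [f', hj]
    rw [Finset.sum_add_distrib, Finset.sum_ite_eq' Finset.univ i, if_pos (Finset.mem_univ i)] at h1
    omega
  · rw [htraj _ h1, htraj _ h2] at h12
    exact hx _ _ h1 h2 h12
  -- The new endpoint is still below q. Freeness at v leaves m₀ as the only possible collision, but
  -- the old endpoint equalled that point and abab has moved it.
  · rw [htraj m hm, trajPoint, htraj l List.suffix_rfl, hsame, ← trajPoint] at hm'
    obtain ⟨z, hz, hz'⟩ := exists_trajPoint_append f v [false, false] ((i, ε) :: l)
    rw [hq] at hz'
    rw [hz', hw] at hm'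
    have h1 : trajPoint f v m = q := (hprefix m).1 (hm' ▸ List.prefix_append _ _)
    have h2 : trajPoint f v m₀ = q :=
      (hprefix m₀).1 (hm₀' ▸ hz' ▸ List.prefix_append _ _)
    have h3 := h _ _ hm hm₀ (h1.trans h2.symm)
    subst h3
    rw [hm', hz'] at hm₀'
    exact wordAct_abab_ne hz (List.append_cancel_left hm₀')

theorem exists_isFreeTraj {k : ℕ} (l : List (Fin k × Bool)) (hl : FreeGroup.IsReduced l) :
    ∃ (f : Fin k → List GrigLetter) (v : List Bool),
      ∑ i, (f i).length ≤ 2 * 9 ^ l.length ∧ v.length = 2 * l.length ∧ IsFreeTraj f v l := by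
  induction l with
  | nil =>
    refine ⟨fun _ => [], [], by simp, rfl, fun l₁ l₂ h1 h2 _ => ?_⟩
    rw [List.suffix_nil.1 h1, List.suffix_nil.1 h2]
  | cons s l ih =>
    obtain ⟨f, v, h1, h2, h3⟩ := ih hl.tail
    obtain ⟨f', h4, h5⟩ := exists_isFreeTraj_cons h3 hl
    refine ⟨f', _, ?_, ?_, h5⟩
    -- With |v| = 2n the increment is 9·9^n, and 2·9^n + 9·9^n ≤ 2·9^(n+1).
    · rw [h2, pow_mul] at h4
      rw [List.length_cons, pow_succ]
      norm_num at h4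
      omega
    · simp [h2, mul_add]

/-- A nontrivial word of length `n` does not vanish at some tuple of elements of total length at most
`2 * 9 ^ n`. -/
theorem exists_lift_ne_one {k : ℕ} {w : FreeGroup (Fin k)} (hw : w ≠ 1) :
    ∃ f : Fin k → List GrigLetter, ∑ i, (f i).length ≤ 2 * 9 ^ w.norm ∧
      FreeGroup.lift (fun i => wordElt (f i)) w ≠ 1 := by
  obtain ⟨f, v, h1, -, h2⟩ := exists_isFreeTraj w.toWord FreeGroup.isReduced_toWord
  refine ⟨f, h1, fun h => hw ?_⟩
  have h3 := lift_mk_apply f w.toWord v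
  rw [FreeGroup.mk_toWord, h] at h3
  exact FreeGroup.toWord_eq_nil_iff.1 (h2 _ _ List.suffix_rfl List.nil_suffix h3.symm)

/-! ### Complexity and lawlessness growth -/

section Complexity

variable {k : ℕ} {G : Type*} [Group G] {S : Set G}

theorem complexity_le {w : FreeGroup (Fin k)} {g : Fin k → G} (hg : FreeGroup.lift g w ≠ 1) :
    complexity S w ≤ ∑ i, wordLength S (g i) :=
  Nat.sInf_le ⟨g, hg, rfl⟩

theorem exists_complexity_eq {w : FreeGroup (Fin k)} (hw : ∃ g : Fin k → G, FreeGroup.lift g w ≠ 1) :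
    ∃ g : Fin k → G, FreeGroup.lift g w ≠ 1 ∧ ∑ i, wordLength S (g i) = complexity S w := by
  obtain ⟨g, hg⟩ := hw
  exact Nat.sInf_mem (s := {m : ℕ | ∃ g : Fin k → G, FreeGroup.lift g w ≠ 1 ∧
    ∑ i, wordLength S (g i) = m}) ⟨_, g, hg, rfl⟩

end Complexity

theorem exists_lift_grigorchukGroup_ne_one {k : ℕ} {w : FreeGroup (Fin k)} (hw : w ≠ 1) :
    ∃ g : Fin k → grigorchukGroup, FreeGroup.lift g w ≠ 1 :=
  let ⟨f, _, h⟩ := exists_lift_ne_one hw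
  ⟨fun i => wordElt (f i), h⟩

theorem not_isLaw_grigorchukGroup {k : ℕ} (w : FreeGroup (Fin k)) :
    ¬ IsLaw grigorchukGroup w := fun h =>
  let ⟨g, hg⟩ := exists_lift_grigorchukGroup_ne_one h.1
  hg (h.2 (FreeGroup.lift g))

section GrigorchukComplexity

variable {k : ℕ} {S : Set grigorchukGroup}

theorem exists_complexity_le (hS : Subgroup.closure S = ⊤) :
    ∃ D : ℕ, ∀ w : FreeGroup (Fin k), w ≠ 1 → complexity S w ≤ D * 9 ^ w.norm := by
  obtain ⟨D, hD⟩ := exists_wordLength_wordElt_le hS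
  refine ⟨D * 2, fun w hw => ?_⟩
  obtain ⟨f, h1, h2⟩ := exists_lift_ne_one hw
  calc complexity S w ≤ ∑ i, wordLength S (wordElt (f i)) := complexity_le h2
    _ ≤ ∑ i, D * (f i).length := Finset.sum_le_sum fun i _ => hD (f i)
    _ ≤ D * (2 * 9 ^ w.norm) := by rw [← Finset.mul_sum]; exact Nat.mul_le_mul_left D h1
    _ = D * 2 * 9 ^ w.norm := by ring

theorem exists_lawlessnessGrowth_le (hS : Subgroup.closure S = ⊤) :
    ∃ D : ℕ, ∀ n, lawlessnessGrowth k S n ≤ D * 9 ^ n := by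
  obtain ⟨D, hD⟩ := exists_complexity_le (k := k) hS
  refine ⟨D, fun n => csSup_le' ?_⟩
  rintro m ⟨w, hw, hn, rfl⟩
  exact (hD w hw).trans (Nat.mul_le_mul_left D (Nat.pow_le_pow_right (by norm_num) hn))

theorem complexity_le_lawlessnessGrowth (hS : Subgroup.closure S = ⊤) {n : ℕ}
    {w : FreeGroup (Fin k)} (hw : w ≠ 1) (hn : w.norm ≤ n) :
    complexity S w ≤ lawlessnessGrowth k S n := by
  obtain ⟨D, hD⟩ := exists_complexity_le (k := k) hS
  -- An unbounded set would have supremum 0 in ℕ; the exponential bound excludes this.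
  refine le_csSup ⟨D * 9 ^ n, ?_⟩ ⟨w, hw, hn, rfl⟩
  rintro m ⟨w, hw, hn, rfl⟩
  exact (hD w hw).trans (Nat.mul_le_mul_left D (Nat.pow_le_pow_right (by norm_num) hn))

theorem one_le_complexity (hS : Subgroup.closure S = ⊤) {w : FreeGroup (Fin k)} (hw : w ≠ 1) :
    1 ≤ complexity S w := by
  obtain ⟨g, h1, h2⟩ := exists_complexity_eq (S := S) (exists_lift_grigorchukGroup_ne_one hw)
  rw [← h2]
  by_contra! h
  rw [Nat.lt_one_iff, Finset.sum_eq_zero_iff] at h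
  have hg : g = fun _ => 1 := funext fun i => by
    by_contra hi
    have h3 := one_le_wordLength hS hi
    rw [h i (Finset.mem_univ i)] at h3
    omega
  refine h1 ?_
  rw [hg]
  have h4 : FreeGroup.lift (fun _ : Fin k => (1 : grigorchukGroup)) = 1 := by ext; simp
  rw [h4, MonoidHom.one_apply]

/-- Elements of word length at most of order `4 ^ r` have order dividing `2 ^ (3 * r + 7)`. -/
theorem wordElt_pow_eq_one {w : List GrigLetter} {r : ℕ} (hw : w.length ≤ 2 ^ (2 * r)) :
    wordElt w ^ 2 ^ (3 * r + 7) = 1 := by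
  refine grigorchukGroup_ext fun v => ?_
  rw [wordElt_pow_apply]
  refine wordAct_iterate_two_pow (2 * r) _ w ((xcount_le_length w).trans hw) ?_ v
  -- With i = 2r, 3i + 6 + 8 = 2(3r + 7).
  have h : torsionWeight w ≤ 6 := by
    unfold torsionWeight
    split <;> first
      | omega
      | (split <;> omega)
  omega

theorem exists_le_complexity_pow (hfin : S.Finite) (hS : Subgroup.closure S = ⊤) (i : Fin k) :
    ∃ D : ℕ, 0 < D ∧ ∀ r : ℕ,
      2 ^ (2 * r) ≤ D * complexity S (FreeGroup.of i ^ 2 ^ (3 * r + 7)) := by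
  obtain ⟨D, hD, h⟩ := exists_wordElt_eq hfin hS
  refine ⟨D, hD, fun r => ?_⟩
  have hw : FreeGroup.of i ^ 2 ^ (3 * r + 7) ≠ 1 := by
    rw [Ne, pow_eq_one_iff_left (by positivity)]
    exact FreeGroup.of_ne_one i
  obtain ⟨g, h1, h2⟩ := exists_complexity_eq (S := S) (exists_lift_grigorchukGroup_ne_one hw)
  obtain ⟨w, h3, h4⟩ := h (g i)
  rw [map_pow, FreeGroup.lift_apply_of, ← h3] at h1
  by_contra! hlt
  refine h1 (wordElt_pow_eq_one (h4.trans (le_trans ?_ hlt.le)))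
  rw [← h2]
  exact Nat.mul_le_mul_left D
    (Finset.single_le_sum (f := fun i => wordLength S (g i)) (fun _ _ => Nat.zero_le _)
      (Finset.mem_univ i))

theorem rpow_two_thirds_le {n r : ℕ} (hn : n ≤ 2 ^ (3 * (r + 4))) :
    (n : ℝ) ^ (2 / 3 : ℝ) ≤ 256 * 2 ^ (2 * r) := by
  have h1 : (n : ℝ) ≤ ((2 : ℝ) ^ (r + 4)) ^ (3 : ℝ) := by
    rw [show (3 : ℝ) = (3 : ℕ) by norm_num, Real.rpow_natCast, ← pow_mul, mul_comm (r + 4)]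
    exact_mod_cast hn
  calc (n : ℝ) ^ (2 / 3 : ℝ) ≤ (((2 : ℝ) ^ (r + 4)) ^ (3 : ℝ)) ^ (2 / 3 : ℝ) :=
        Real.rpow_le_rpow n.cast_nonneg h1 (by norm_num)
    _ = ((2 : ℝ) ^ (r + 4)) ^ (2 : ℕ) := by
        rw [← Real.rpow_mul (by positivity), ← Real.rpow_natCast]
        norm_num
    _ = 256 * 2 ^ (2 * r) := by ring

theorem exists_rpow_le_lawlessnessGrowth (hk : 0 < k) (hfin : S.Finite)
    (hS : Subgroup.closure S = ⊤) :
    ∃ c : ℝ, 0 < c ∧ ∀ n : ℕ, c * (n : ℝ) ^ (2 / 3 : ℝ) ≤ (lawlessnessGrowth k S n : ℝ) := by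
  let i : Fin k := ⟨0, hk⟩
  obtain ⟨D, hD, h⟩ := exists_le_complexity_pow hfin hS i
  have hD' : (1 : ℝ) ≤ D := by exact_mod_cast hD
  have hpos : (0 : ℝ) < 256 * D := by positivity
  refine ⟨(256 * D)⁻¹, inv_pos.2 hpos, fun n => ?_⟩
  rw [inv_mul_le_iff₀ hpos]
  rcases Nat.eq_zero_or_pos n with rfl | hn
  · rw [Nat.cast_zero, Real.zero_rpow (by norm_num)]
    positivity
  rcases lt_or_ge n 128 with hn' | hn'
  -- Below 2^7 no test power is short enough; a single generator gives growth at least 1, and the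
  -- constant 256 covers n^(2/3).
  · have h1 : (1 : ℝ) ≤ lawlessnessGrowth k S n := by
      exact_mod_cast (one_le_complexity hS (FreeGroup.of_ne_one i)).trans
        (complexity_le_lawlessnessGrowth hS (FreeGroup.of_ne_one i) (by
          rw [FreeGroup.norm_of]; exact hn))
    have h2 := rpow_two_thirds_le (n := n) (r := 0) (by norm_num; omega)
    norm_num at h2
    nlinarith
  · obtain ⟨r, h1, h2⟩ : ∃ r, 2 ^ (3 * r + 7) ≤ n ∧ n ≤ 2 ^ (3 * (r + 4)) := by
      have h1 : 7 ≤ Nat.log 2 n := Nat.le_log_of_pow_le (by norm_num) hn'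
      -- The largest r whose test power has length at most n; rounding down loses only a constant
      -- factor.
      refine ⟨(Nat.log 2 n - 7) / 3, ?_, ?_⟩
      · exact (Nat.pow_le_pow_right (by norm_num) (by omega)).trans
          (Nat.pow_log_le_self 2 hn.ne')
      · exact (Nat.lt_pow_succ_log_self (by norm_num) n).le.trans
          (Nat.pow_le_pow_right (by norm_num) (by omega))
    refine (rpow_two_thirds_le h2).trans ?_
    rw [mul_assoc]
    refine mul_le_mul_of_nonneg_left ?_ (by norm_num)
    have h3 := (h r).trans (Nat.mul_le_mul_left D (complexity_le_lawlessnessGrowth hS (n := n) (by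
      rw [Ne, pow_eq_one_iff_left (by positivity)]
      exact FreeGroup.of_ne_one i) (by rw [FreeGroup.norm_of_pow]; exact h1)))
    exact_mod_cast h3

end GrigorchukComplexity

theorem theorem4 (k : ℕ) (hk : 2 ≤ k) (S : Set grigorchukGroup) (hS : S.Finite)
    (hgen : Subgroup.closure S = ⊤) :
    (∀ w : FreeGroup (Fin k), ¬ IsLaw grigorchukGroup w) ∧
      ∃ C : ℝ, 0 < C ∧
        (∃ c : ℝ, 0 < c ∧ ∀ n : ℕ, c * (n : ℝ) ^ (2 / 3 : ℝ) ≤ (lawlessnessGrowth k S n : ℝ)) ∧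
        (∃ K : ℝ, 0 < K ∧ ∀ n : ℕ, (lawlessnessGrowth k S n : ℝ) ≤ K * Real.exp (C * n)) := by
  refine ⟨not_isLaw_grigorchukGroup, Real.log 9, Real.log_pos (by norm_num),
    exists_rpow_le_lawlessnessGrowth (by omega) hS hgen, ?_⟩
  obtain ⟨D, hD⟩ := exists_lawlessnessGrowth_le (k := k) hgen
  refine ⟨D + 1, by positivity, fun n => ?_⟩
  rw [mul_comm (Real.log 9), ← Real.log_pow, Real.exp_log (by positivity)]
  have h : (lawlessnessGrowth k S n : ℝ) ≤ D * 9 ^ n := by exact_mod_cast hD n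
  refine h.trans ?_
  gcongr
  linarith
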